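/- Let $n=(k-1)k/2+r$ with integers $0<r\le k$. Let $\mathcal P(n)$ be the set of partitions of $n$, and let $\mathcal B:\mathcal P(n)\to\mathcal P(n)$ be the move of the Bulgarian solitaire: for $\lambda=(\lambda_1,\ldots,\lambda_c)$ with all $\lambda_i>0$, $\mathcal B(\lambda)$ is the partition with parts $c,\lambda_1-1,\ldots,\lambda_c-1$, sorted and with zeros discarded. The Young diagram $[\lambda]$ of $\lambda_1\ge\lambda_2\ge\cdots\ge\lambda_c$ is the set of boxes $(i,j)$ with $1\le i\le c$, $1\le j\le\lambda_i$; the box $(i,j)$ lies on level $i+j-1$, and level $k$ has the $k$ places $(i,k+1-i)$, $i=1,\ldots,k$. Call $\lambda\in\mathcal P(n)$ *triangular plus surplus* if levels $1,\ldots,k-1$ of $[\lambda]$ are completely filled and $[\lambda]$ has no boxes above level $k$. Then: 1. For every $\lambda\in\mathcal P(n)$, all partitions $\mathcal B^s(\lambda)$ with $s$ sufficiently large are triangular plus surplus and lie on a cycle of $\mathcal B$. A partition of $n$ lies on a cycle of $\mathcal B$ if and only if it is triangular plus surplus. 2. If $\lambda$ is triangular plus surplus, then exactly $r$ of the $k$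 places of level $k$ are occupied by boxes, and $\mathcal B$ rotates this level cyclically by one place: place $i+1$ (modulo $k$) of level $k$ is occupied in $[\mathcal B(\lambda)]$ if and only if place $i$ is occupied in $[\lambda]$. 3. Consider the oriented graph with vertex set $\mathcal P(n)$ and edges $(\lambda,\mathcal B(\lambda))$, and the necklaces with $r$ black and $k-r$ white beads, i.e. the orbits of the colourings of the $k$ elements of $\mathbb Z/k$ with exactly $r$ black elements under the rotations by the cyclic group of order $k$. There is a bijection from the (weakly) connected components of the graph to these necklaces that sends the component of each triangular plus surplus partition $\lambda$ to the necklace whose $i$-th bead is black exactly when the $i$-th place of level $k$ of $[\lambda]$ is occupied. 4. The number $C(n)$ of components of the graph equals the number of these necklaces, and $$C(n)=\frac1k\sum_{d\mid\gcd(r,k)}\varphi(d)\binom{k/d}{r/d},$$ where $\varphi$ is Euler's function. -/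

import Mathlib

namespace BulgarianSolitaire

/-- The multiset of pile sizes after one move: one card is taken from every pile, and the removed
cards form a new pile. Piles may have become empty. -/
def newPiles {n : ℕ} (p : n.Partition) : Multiset ℕ :=
  Multiset.card p.parts ::ₘ p.parts.map (fun a => a - 1)

theorem sum_newPiles {n : ℕ} (p : n.Partition) : (newPiles p).sum = n := by
  have key : ∀ s : Multiset ℕ, (∀ a ∈ s, 0 < a) →
      Multiset.card s + (s.map (fun a => a - 1)).sum = s.sum := by
    intro s
    induction s using Multiset.induction with
    | empty => simp
    | cons a s ih =>
      intro h
      have h1 := h a (Multiset.mem_cons_self a s)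
      have h2 := ih (fun b hb => h b (Multiset.mem_cons_of_mem hb))
      simp only [Multiset.card_cons, Multiset.map_cons, Multiset.sum_cons]
      omega
  have := key p.parts (fun a ha => p.parts_pos ha)
  rw [p.parts_sum] at this
  simpa [newPiles] using this

/-- The move of the solitaire; empty piles are discarded. -/
def move {n : ℕ} (p : n.Partition) : n.Partition :=
  Nat.Partition.ofSums n (newPiles p) (sum_newPiles p)

/-- The Young diagram of a partition `λ₀ ≥ λ₁ ≥ …`: the box `(i, j)`, numbered from `0`, belongs to
it iff `j < λᵢ` (the `j`-th card of the `i`-th largest pile). -/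
def diagram {n : ℕ} (p : n.Partition) : YoungDiagram :=
  YoungDiagram.ofRowLens (p.parts.sort (· ≥ ·)) (p.parts.pairwise_sort (· ≥ ·)).sortedGE

/-- In the cradle model the box `(i, j)` (numbered from `0`) lies on level `i + j + 1`.
`IsTriangularPlus k p` says that levels `1, …, k - 1` are completely filled (the triangular
partition `(k - 1, …, 2, 1)` at the bottom), and that there are no boxes above level `k`. -/
def IsTriangularPlus (k : ℕ) {n : ℕ} (p : n.Partition) : Prop :=
  (∀ i j : ℕ, i + j + 1 < k → (i, j) ∈ diagram p) ∧
    ∀ i j : ℕ, (i, j) ∈ diagram p → i + j + 1 ≤ k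

/-- Occupation of level `k` in the cradle model (for `0 < k`): place `i ∈ {0, …, k - 1}` is the
position `(i, k - 1 - i)`, and it is `true` (black) iff there is a box there. -/
def level (k : ℕ) {n : ℕ} (p : n.Partition) : ZMod k → Bool :=
  fun i => decide ((i.val, k - 1 - i.val) ∈ diagram p)

/-- The oriented graph on the partitions of `n` with the edges `(λ, move λ)`. -/
def graph (n : ℕ) : Digraph n.Partition where
  Adj p q := q = move p

/-- The (weakly connected) components of that oriented graph. -/
abbrev Component (n : ℕ) : Type :=
  (graph n).toSimpleGraphInclusive.ConnectedComponent

/-- The component of a partition. -/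
def component {n : ℕ} (p : n.Partition) : Component n :=
  (graph n).toSimpleGraphInclusive.connectedComponentMk p

/-- Colourings of `k` places on a circle with exactly `r` black (`true`) beads, the remaining
beads being white. -/
@[ext]
structure Coloring (k r : ℕ) where
  /-- the colour of each bead -/
  color : ZMod k → Bool
  /-- there are exactly `r` black beads -/
  ncard_black : {i | color i = true}.ncard = r

/-- The cyclic group of order `k` acts by rotations: `t` moves the bead at place `i` to the place
`i + t`. -/
instance (k r : ℕ) : AddAction (ZMod k) (Coloring k r) where
  vadd t c :=
    { color := fun i => c.color (i - t)
      ncard_black := by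
        refine Eq.trans ?_ c.ncard_black
        rw [← Set.ncard_image_of_injective {i | c.color i = true} (add_left_injective t)]
        congr 1
        ext i
        simp [sub_eq_add_neg] }
  zero_vadd c := Coloring.ext (funext fun i => congrArg c.color (sub_zero i))
  add_vadd s t c := Coloring.ext (funext fun i => congrArg c.color (sub_add_eq_sub_sub i s t))

/-- Necklaces with `r` black and `k - r` white beads: orbits of colourings under the cyclic group
of order `k`. -/
abbrev Necklace (k r : ℕ) : Type :=
  AddAction.orbitRel.Quotient (ZMod k) (Coloring k r)

/-- The necklace of a colouring. -/
def necklace {k r : ℕ} (c : Coloring k r) : Necklace k r :=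
  Quotient.mk _ c

end BulgarianSolitaire

namespace BulgarianSolitaire

variable {n : ℕ}

/-! A move takes off the first column and inserts it as a new row. If this row is placed on top,
every level of the diagram is rotated by one place and the total level of the boxes is unchanged;
sorting the rows afterwards can only lower it. On a cycle this energy is constant, so no sorting is
ever needed there (`balanced_iterate_of_mem_periodicPts`) and each level `l` simply rotates with
period `l`.

Since `l` and `l + 1` are coprime, any place of level `l` and any place of level `l + 1` eventually
reach the first row together, where an empty place forces its right neighbour to be empty. A gap on
level `l` therefore empties level `l + 1` (`level_full_or_empty`), and counting boxes leaves only
the triangular plus surplus shape (`isTriangularPlus_of_balanced`). Conversely, such a partition is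
determined by its level `k`, which returns to itself after `k` moves.

Each component thus contains the cycle of a single rotation orbit of level `k`, which is a necklace;
every colouring occurs. Burnside's lemma counts the necklaces. -/

/-! ### Column heights and their change under a move. -/

theorem exists_getElem_gt_iff_lt_countP (l : List ℕ) (hl : l.SortedGE) (i j : ℕ) :
    (∃ h : i < l.length, j < l[i]) ↔ i < l.countP (j < ·) := by
  induction l generalizing i with
  | nil => simp
  | cons a l ih =>
    have hl' := List.pairwise_cons.1 hl.pairwise
    by_cases ha : j < a
    · cases i with
      | zero => simp [ha]
      | succ i => simpa [ha] using ih hl'.2.sortedGE i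
    · have h0 : (a :: l).countP (j < ·) = 0 := by
        rw [List.countP_eq_zero]
        intro b hb
        rcases List.mem_cons.1 hb with rfl | hb
        · simpa using ha
        · have := hl'.1 b hb
          simp only [decide_eq_true_eq]
          omega
      rw [h0]
      simp only [not_lt_zero, iff_false, not_exists]
      intro h hj
      have hm := List.getElem_mem h
      rw [List.countP_eq_zero] at h0
      exact h0 _ hm (by simpa using hj)

/-- Column `j` has as many boxes as there are piles larger than `j`. Column heights do not depend on
the order of the piles, so the sorting in a move never has to be handled. -/
theorem mem_diagram_iff (p : n.Partition) (i j : ℕ) :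
    (i, j) ∈ diagram p ↔ i < p.parts.countP (j < ·) := by
  rw [diagram, YoungDiagram.mem_ofRowLens, exists_getElem_gt_iff_lt_countP _
    (p.parts.pairwise_sort (· ≥ ·)).sortedGE, ← Multiset.coe_countP, Multiset.sort_eq]

theorem countP_pos_parts (p : n.Partition) : p.parts.countP (0 < ·) = Multiset.card p.parts :=
  Multiset.countP_eq_card.2 fun _ ha => p.parts_pos ha

theorem move_parts (p : n.Partition) : (move p).parts = (newPiles p).filter (· ≠ 0) := rfl

theorem countP_move (p : n.Partition) (j : ℕ) :
    (move p).parts.countP (j < ·) =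
      p.parts.countP (j + 1 < ·) + if j < p.parts.countP (0 < ·) then 1 else 0 := by
  rw [move_parts, Multiset.countP_filter, countP_pos_parts]
  have : ∀ s : Multiset ℕ, s.countP (fun a => j < a ∧ a ≠ 0) = s.countP (j < ·) := by
    intro s
    refine Multiset.countP_congr rfl fun a _ => propext ?_
    omega
  rw [this, newPiles, Multiset.countP_cons, Multiset.countP_map, ← Multiset.countP_eq_card_filter]
  congr 1
  exact Multiset.countP_congr rfl fun a _ => propext (by omega)

/-! ### Balanced positions: a move rotates every level. -/

/-- A position is balanced if its first row exceeds its first column by at most one box, so that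
no sorting is needed after rotating the diagram. -/
def Balanced (p : n.Partition) : Prop :=
  ∀ j, (0, j + 1) ∈ diagram p → (j, 0) ∈ diagram p

/-- By `countP_move`, column `j` of the new diagram is the old column `j + 1`, plus one box if the
new pile reaches it. Balance says that the new pile reaches every nonempty column, hence it is a
longest row. -/
theorem Balanced.mem_diagram_move_zero {p : n.Partition} (hp : Balanced p) (j : ℕ) :
    (0, j) ∈ diagram (move p) ↔ (j, 0) ∈ diagram p := by
  have := hp j
  simp only [mem_diagram_iff, countP_move] at this ⊢
  split_ifs <;> omega

theorem Balanced.mem_diagram_move_succ {p : n.Partition} (hp : Balanced p) (i j : ℕ) :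
    (i + 1, j) ∈ diagram (move p) ↔ (i, j + 1) ∈ diagram p := by
  have := hp j
  simp only [mem_diagram_iff, countP_move] at this ⊢
  split_ifs <;> omega

theorem Balanced.level_move {p : n.Partition} (hp : Balanced p) (l : ℕ) [NeZero l] (i : ZMod l) :
    level l (move p) (i + 1) = level l p i := by
  have hi := i.val_lt
  have hv : (i + 1).val = if i.val + 1 = l then 0 else i.val + 1 := by
    rw [ZMod.val_add, ZMod.val_one_eq_one_mod, Nat.add_mod_mod]
    split_ifs with h
    · rw [h, Nat.mod_self]
    · exact Nat.mod_eq_of_lt (by omega)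
  simp only [level, hv, decide_eq_decide]
  split_ifs with h
  · rw [hp.mem_diagram_move_zero]
    have h1 : l - 1 - 0 = i.val := by omega
    have h2 : l - 1 - i.val = 0 := by omega
    rw [h1, h2]
  · rw [hp.mem_diagram_move_succ]
    have h1 : l - 1 - (i.val + 1) + 1 = l - 1 - i.val := by omega
    rw [h1]

theorem level_iterate_move {p : n.Partition} (hp : ∀ t, Balanced (move^[t] p)) (l : ℕ) [NeZero l]
    (t : ℕ) (i : ZMod l) : level l (move^[t] p) (i + t) = level l p i := by
  induction t with
  | zero => simp
  | succ t ih =>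
    rw [Function.iterate_succ_apply', Nat.cast_succ, ← add_assoc, (hp t).level_move, ih]

/-! ### The energy, which is constant on cycles. -/

/-- Twice the sum of the levels of all boxes, written as a symmetric function of the piles. -/
def energy (s : Multiset ℕ) : ℕ :=
  (s.map fun a => a ^ 2).sum + (s.map fun a => (s.map fun b => min a b).sum).sum

theorem sum_map_filter_ne_zero (s : Multiset ℕ) (f : ℕ → ℕ) (hf : f 0 = 0) :
    ((s.filter (· ≠ 0)).map f).sum = (s.map f).sum := by
  induction s using Multiset.induction with
  | empty => simp
  | cons a s ih =>
    by_cases ha : a = 0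
    · simpa [ha, hf] using ih
    · simpa [ha] using ih

theorem energy_filter_ne_zero (s : Multiset ℕ) : energy (s.filter (· ≠ 0)) = energy s := by
  unfold energy
  rw [sum_map_filter_ne_zero _ _ (by simp)]
  congr 1
  rw [sum_map_filter_ne_zero _ _ (by simp)]
  refine congrArg Multiset.sum (Multiset.map_congr rfl fun a _ => ?_)
  exact sum_map_filter_ne_zero _ _ (by simp)

theorem energy_cons (c : ℕ) (s : Multiset ℕ) :
    energy (c ::ₘ s) = c ^ 2 + c + 2 * (s.map fun a => min c a).sum + energy s := by
  simp only [energy, Multiset.map_cons, Multiset.sum_cons, Multiset.sum_map_add, min_self,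
    min_comm _ c]
  ring

/-- Deleting the first column, of height `c`, lowers each remaining box by one level and loses the
column's own contribution `2 * (1 + ... + c) = c ^ 2 + c`. -/
theorem energy_map_pred (s : Multiset ℕ) (hs : ∀ a ∈ s, 0 < a) :
    energy (s.map fun a => a - 1) + 2 * (s.map fun a => a - 1).sum + Multiset.card s +
      Multiset.card s ^ 2 = energy s := by
  induction s using Multiset.induction with
  | empty => simp [energy]
  | cons b s ih =>
    have hb := hs b (Multiset.mem_cons_self b s)
    have hs' : ∀ a ∈ s, 0 < a := fun a ha => hs a (Multiset.mem_cons_of_mem ha)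
    have key : (s.map fun a => min (b - 1) (a - 1)).sum + Multiset.card s =
        (s.map fun a => min b a).sum := by
      clear ih hs
      induction s using Multiset.induction with
      | empty => simp
      | cons a s ih =>
        have ha := hs' a (Multiset.mem_cons_self a s)
        have := ih fun a ha => hs' a (Multiset.mem_cons_of_mem ha)
        simp only [Multiset.map_cons, Multiset.sum_cons, Multiset.card_cons]
        omega
    have := ih hs'
    simp only [Multiset.map_cons, energy_cons, Multiset.sum_cons, Multiset.card_cons,
      Multiset.map_map, Function.comp_def] at this ⊢
    obtain ⟨b, rfl⟩ := Nat.exists_eq_succ_of_ne_zero hb.ne'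
    simp only [Nat.succ_eq_add_one, Nat.add_sub_cancel] at key ⊢
    nlinarith

/-- The inserted pile `c` interacts with a shortened pile `a - 1` through `min c (a - 1)`, whereas
deleting the column cost `a - 1`. The difference is the truncated `a - 1 - c`, nonzero only for
piles too long for the new row to be placed on top. -/
theorem energy_move (p : n.Partition) :
    energy (move p).parts + 2 * (p.parts.map fun a => a - 1 - Multiset.card p.parts).sum =
      energy p.parts := by
  rw [move_parts, energy_filter_ne_zero, newPiles, energy_cons,
    ← energy_map_pred p.parts fun a ha => p.parts_pos ha, Multiset.map_map]
  have : ∀ (c : ℕ) (s : Multiset ℕ),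
      (s.map (min c ∘ fun a => a - 1)).sum + (s.map fun a => a - 1 - c).sum =
        (s.map fun a => a - 1).sum := by
    intro c s
    rw [← Multiset.sum_map_add]
    refine congrArg Multiset.sum (Multiset.map_congr rfl fun a _ => ?_)
    simp only [Function.comp]
    omega
  have := this (Multiset.card p.parts) p.parts
  simp only [Function.comp_def] at this ⊢
  omega

theorem energy_move_le (p : n.Partition) : energy (move p).parts ≤ energy p.parts := by
  have := energy_move p
  omega

theorem balanced_of_energy_le {p : n.Partition} (h : energy p.parts ≤ energy (move p).parts) :
    Balanced p := by
  have h0 : (p.parts.map fun a => a - 1 - Multiset.card p.parts).sum = 0 := by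
    have := energy_move p
    omega
  intro j hj
  rw [mem_diagram_iff, Multiset.countP_pos] at hj
  obtain ⟨a, ha, hja⟩ := hj
  have := (Multiset.sum_eq_zero_iff.1 h0) _ (Multiset.mem_map_of_mem _ ha)
  rw [mem_diagram_iff, countP_pos_parts]
  omega

theorem balanced_iterate_of_mem_periodicPts {p : n.Partition}
    (hp : p ∈ Function.periodicPts (move (n := n))) (t : ℕ) : Balanced (move^[t] p) := by
  obtain ⟨m, hm, hper⟩ := hp
  have hanti : Antitone fun s => energy (move^[s] p).parts :=
    antitone_nat_of_succ_le fun s => by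
      rw [Function.iterate_succ_apply']
      exact energy_move_le _
  apply balanced_of_energy_le
  rw [← Function.iterate_succ_apply' move]
  have h1 : move^[t + m] p = move^[t] p := by
    rw [Function.iterate_add_apply, hper.eq]
  -- The energy at time `t + 1` is at least that at `t + m`, which is that at `t` by periodicity.
  have h2 := hanti (show t + 1 ≤ t + m by omega)
  simpa only [h1] using h2

/-! ### Comparison of consecutive levels through coprime periods. -/

theorem level_full_or_empty {p : n.Partition} (hp : ∀ t, Balanced (move^[t] p)) (l : ℕ)
    [NeZero l] (x : ZMod l) (y : ZMod (l + 1)) (hx : level l p x = false) :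
    level (l + 1) p y = false := by
  have hcop : Nat.Coprime l (l + 1) := Nat.coprime_self_add_right.2 (Nat.coprime_one_right l)
  -- At time `t` both places have rotated to place `0`, that is to the boxes `(0, l - 1)` and `(0,
  -- l)`.
  obtain ⟨t, ht1, ht2⟩ := Nat.chineseRemainder hcop (-x).val (-y).val
  have e1 : (t : ZMod l) = -x := by
    rw [(ZMod.natCast_eq_natCast_iff _ _ _).2 ht1, ZMod.natCast_zmod_val]
  have e2 : (t : ZMod (l + 1)) = -y := by
    rw [(ZMod.natCast_eq_natCast_iff _ _ _).2 ht2, ZMod.natCast_zmod_val]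
  have l1 := level_iterate_move hp l t x
  have l2 := level_iterate_move hp (l + 1) t y
  rw [e1, add_neg_cancel, hx] at l1
  rw [e2, add_neg_cancel] at l2
  rw [← l2]
  simp only [level, ZMod.val_zero, decide_eq_false_iff_not] at l1 ⊢
  exact fun h => l1 ((diagram _).up_left_mem le_rfl (by omega) h)

theorem mem_diagram_of_mem_next_level {p : n.Partition} (hp : ∀ t, Balanced (move^[t] p))
    {i j i' j' : ℕ} (h : i' + j' = i + j + 1) (h' : (i', j') ∈ diagram p) : (i, j) ∈ diagram p := by
  by_contra hij
  have hx : level (i + j + 1) p ((i : ℕ) : ZMod (i + j + 1)) = false := by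
    simp only [level, decide_eq_false_iff_not]
    rw [ZMod.val_cast_of_lt (by omega)]
    convert hij using 3
    omega
  have hy := level_full_or_empty hp (i + j + 1) _ ((i' : ℕ) : ZMod (i + j + 1 + 1)) hx
  simp only [level, decide_eq_false_iff_not] at hy
  rw [ZMod.val_cast_of_lt (by omega)] at hy
  apply hy
  convert h' using 3
  omega

theorem mem_diagram_of_lt {p : n.Partition} (hp : ∀ t, Balanced (move^[t] p))
    {i j i' j' : ℕ} (h : i + j < i' + j') (h' : (i', j') ∈ diagram p) : (i, j) ∈ diagram p := by
  -- This box is weakly up-left of `(i', j')` and lies on the level just above that of `(i, j)`.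
  have h2 : (min i' (i + j + 1), i + j + 1 - min i' (i + j + 1)) ∈ diagram p :=
    (diagram p).up_left_mem (by omega) (by omega) h'
  exact mem_diagram_of_mem_next_level hp (by omega) h2

/-! ### Box counts force the triangular shape. -/

theorem card_cellsOfRowLens (w : List ℕ) : (YoungDiagram.cellsOfRowLens w).card = w.sum := by
  induction w with
  | nil => simp [YoungDiagram.cellsOfRowLens]
  | cons a w ih =>
    rw [YoungDiagram.cellsOfRowLens, Finset.card_union_of_disjoint, Finset.card_map, ih]
    · simp
    · rw [Finset.disjoint_left]
      rintro ⟨i, j⟩ h1 h2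
      simp only [Finset.mem_product, Finset.mem_singleton] at h1
      simp [h1.1] at h2

theorem card_diagram (p : n.Partition) : (diagram p).cells.card = n := by
  rw [diagram, YoungDiagram.ofRowLens, card_cellsOfRowLens, ← Multiset.sum_coe, Multiset.sort_eq,
    p.parts_sum]

/-- The boxes on levels `1, …, m`. -/
def staircase (m : ℕ) : Finset (ℕ × ℕ) :=
  (Finset.range m).biUnion Finset.HasAntidiagonal.antidiagonal

theorem mem_staircase {m : ℕ} {x : ℕ × ℕ} : x ∈ staircase m ↔ x.1 + x.2 < m := by
  simp [staircase]

theorem card_staircase (m : ℕ) : (staircase m).card = m * (m + 1) / 2 := by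
  rw [staircase, Finset.card_biUnion]
  · simp only [Finset.Nat.card_antidiagonal]
    induction m with
    | zero => rfl
    | succ m ih =>
      rw [Finset.sum_range_succ, ih]
      have h : (m + 1) * (m + 1 + 1) = m * (m + 1) + 2 * (m + 1) := by ring
      omega
  · intro a _ b _ hab
    rw [Function.onFun, Finset.disjoint_left]
    intro x hx hx'
    rw [Finset.HasAntidiagonal.mem_antidiagonal] at hx hx'
    omega

theorem isTriangularPlus_of_balanced {k r : ℕ} (hr : 0 < r) (hrk : r ≤ k)
    (hn : n = (k - 1) * k / 2 + r) {p : n.Partition} (hp : ∀ t, Balanced (move^[t] p)) :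
    IsTriangularPlus k p := by
  obtain ⟨m, rfl⟩ : ∃ m, k = m + 1 := ⟨k - 1, by omega⟩
  have hs : (staircase (m + 1)).card = (staircase m).card + (m + 1) := by
    simp only [card_staircase]
    have h : (m + 1) * (m + 1 + 1) = m * (m + 1) + 2 * (m + 1) := by ring
    omega
  have hn' : n = (staircase m).card + r := by rw [hn, card_staircase]; rfl
  constructor
  · intro i j hij
    by_contra hmem
    -- A gap below level `k` confines all boxes to levels up to `k - 1`, leaving no room for the
    -- surplus since `0 < r`.
    have hsub : (diagram p).cells ⊆ staircase m := by
      rintro ⟨a, b⟩ hab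
      rw [mem_staircase]
      by_contra hlt
      exact hmem (mem_diagram_of_lt hp (by simp only at hlt; omega) hab)
    have := Finset.card_le_card hsub
    rw [card_diagram] at this
    omega
  · intro i j hmem
    by_contra hij
    -- A box above level `k` fills levels `1` to `k`, so there would be more boxes than `r ≤ k`
    -- allows.
    have hsub : insert (i, j) (staircase (m + 1)) ⊆ (diagram p).cells := by
      intro x hx
      rcases Finset.mem_insert.1 hx with rfl | hx
      · exact hmem
      · rw [mem_staircase] at hx
        exact mem_diagram_of_lt hp (by omega) hmem
    have := Finset.card_le_card hsub
    rw [card_diagram, Finset.card_insert_of_notMem] at this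
    · omega
    · rw [mem_staircase]
      simp only
      omega

/-! ### Triangular plus surplus partitions are closed under the move and periodic. -/

theorem IsTriangularPlus.balanced {k : ℕ} {p : n.Partition} (hp : IsTriangularPlus k p) :
    Balanced p := fun j hj => hp.1 _ _ (by have := hp.2 _ _ hj; omega)

theorem IsTriangularPlus.move {k : ℕ} {p : n.Partition} (hp : IsTriangularPlus k p) :
    IsTriangularPlus k (move p) := by
  constructor
  · rintro (_ | i) j hij
    · rw [hp.balanced.mem_diagram_move_zero]
      exact hp.1 _ _ (by omega)
    · rw [hp.balanced.mem_diagram_move_succ]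
      exact hp.1 _ _ (by omega)
  · rintro (_ | i) j hij
    · rw [hp.balanced.mem_diagram_move_zero] at hij
      have := hp.2 _ _ hij
      omega
    · rw [hp.balanced.mem_diagram_move_succ] at hij
      have := hp.2 _ _ hij
      omega

theorem IsTriangularPlus.iterate_move {k : ℕ} {p : n.Partition} (hp : IsTriangularPlus k p)
    (t : ℕ) : IsTriangularPlus k (BulgarianSolitaire.move^[t] p) := by
  induction t with
  | zero => exact hp
  | succ t ih =>
    rw [Function.iterate_succ_apply']
    exact ih.move

theorem IsTriangularPlus.level_iterate {k : ℕ} [NeZero k] {p : n.Partition}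
    (hp : IsTriangularPlus k p) (t : ℕ) (i : ZMod k) :
    level k (BulgarianSolitaire.move^[t] p) (i + t) = level k p i :=
  level_iterate_move (fun t => (hp.iterate_move t).balanced) k t i

theorem diagram_injective : Function.Injective (diagram (n := n)) := by
  intro p q h
  have hpos : ∀ p : n.Partition, ∀ x ∈ p.parts.sort (· ≥ ·), 0 < x := fun p x hx =>
    p.parts_pos ((Multiset.mem_sort _).1 hx)
  have h' := congrArg YoungDiagram.rowLens h
  rw [diagram, diagram, YoungDiagram.rowLens_ofRowLens_eq_self (hpos p),
    YoungDiagram.rowLens_ofRowLens_eq_self (hpos q)] at h'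
  have h2 := congrArg (fun l : List ℕ => (l : Multiset ℕ)) h'
  simp only [Multiset.sort_eq] at h2
  exact Nat.Partition.ext h2

theorem level_natCast {k i j : ℕ} (h : i + j + 1 = k) (p : n.Partition) :
    level k p (i : ZMod k) = true ↔ (i, j) ∈ diagram p := by
  have hj : k - 1 - i = j := by omega
  rw [level, decide_eq_true_iff, ZMod.val_cast_of_lt (by omega), hj]

theorem IsTriangularPlus.eq_of_level_eq {k : ℕ} {p q : n.Partition}
    (hp : IsTriangularPlus k p) (hq : IsTriangularPlus k q) (h : level k p = level k q) :
    p = q := by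
  apply diagram_injective
  ext ⟨i, j⟩
  simp only [YoungDiagram.mem_cells]
  rcases lt_trichotomy (i + j + 1) k with hlt | heq | hgt
  · exact iff_of_true (hp.1 _ _ hlt) (hq.1 _ _ hlt)
  · rw [← level_natCast heq, ← level_natCast heq, h]
  · exact iff_of_false (fun h => by have := hp.2 _ _ h; omega)
      (fun h => by have := hq.2 _ _ h; omega)

theorem IsTriangularPlus.mem_periodicPts {k : ℕ} [NeZero k] {p : n.Partition}
    (hp : IsTriangularPlus k p) : p ∈ Function.periodicPts (BulgarianSolitaire.move (n := n)) := by
  refine Function.mk_mem_periodicPts (NeZero.pos k) (n := k) ?_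
  refine (hp.iterate_move k).eq_of_level_eq hp (funext fun i => ?_)
  simpa using hp.level_iterate k i

theorem exists_iterate_mem_periodicPts {α : Type*} [Finite α] (f : α → α) (x : α) :
    ∃ s, f^[s] x ∈ Function.periodicPts f := by
  obtain ⟨a, b, hab, h⟩ := Finite.exists_ne_map_eq_of_infinite fun s => f^[s] x
  wlog hlt : a < b generalizing a b
  · exact this b a hab.symm h.symm (by omega)
  refine ⟨a, Function.mk_mem_periodicPts (n := b - a) (by omega) ?_⟩
  rw [Function.IsPeriodicPt, Function.IsFixedPt, ← Function.iterate_add_apply,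
    Nat.sub_add_cancel hlt.le]
  exact h.symm

/-! ### Realization of every colouring of level `k`. -/

/-- The position of place `i` on level `k`. -/
def place (k : ℕ) (i : ZMod k) : ℕ × ℕ := (i.val, k - 1 - i.val)

theorem place_injective (k : ℕ) [NeZero k] : Function.Injective (place k) := fun _ _ h =>
  ZMod.val_injective k (congrArg Prod.fst h)

/-- The diagram whose levels below `k` are full and whose level `k` is occupied as prescribed. -/
def colorDiagram (k : ℕ) [NeZero k] (c : ZMod k → Bool) : YoungDiagram where
  cells := staircase (k - 1) ∪ (Finset.univ.filter fun i => c i = true).image (place k)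
  isLowerSet := by
    rintro ⟨i, j⟩ ⟨i', j'⟩ ⟨hi : i' ≤ i, hj : j' ≤ j⟩ h
    simp only [Finset.coe_union, Set.mem_union, Finset.mem_coe, mem_staircase] at h ⊢
    rcases h with h | h
    · exact Or.inl (by omega)
    · rcases (show i' + j' ≤ i + j by omega).eq_or_lt with heq | hlt
      · obtain rfl : i' = i := by omega
        obtain rfl : j' = j := by omega
        exact Or.inr h
      · left
        obtain ⟨x, _, hx⟩ := Finset.mem_image.1 h
        have := x.val_lt
        simp only [place, Prod.mk.injEq] at hx
        omega

theorem mem_colorDiagram {k : ℕ} [NeZero k] {c : ZMod k → Bool} {i j : ℕ} :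
    (i, j) ∈ colorDiagram k c ↔ i + j + 1 < k ∨ i + j + 1 = k ∧ c (i : ZMod k) = true := by
  rw [← YoungDiagram.mem_cells, colorDiagram]
  simp only [Finset.mem_union, mem_staircase, Finset.mem_image, Finset.mem_filter,
    Finset.mem_univ, true_and, place, Prod.mk.injEq]
  refine or_congr (by omega) ⟨?_, ?_⟩
  · rintro ⟨x, hx, rfl, rfl⟩
    have := x.val_lt
    exact ⟨by omega, by rwa [ZMod.natCast_zmod_val]⟩
  · rintro ⟨h, hc⟩
    have hv : (i : ZMod k).val = i := ZMod.val_cast_of_lt (by omega)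
    exact ⟨_, hc, hv, by omega⟩

theorem card_colorDiagram {k : ℕ} [NeZero k] (c : ZMod k → Bool) :
    (colorDiagram k c).cells.card = (k - 1) * k / 2 + {i | c i = true}.ncard := by
  have hk := NeZero.pos k
  rw [colorDiagram, Finset.card_union_of_disjoint, card_staircase, Nat.sub_add_cancel hk,
    Finset.card_image_of_injective _ (place_injective k), ← Set.ncard_coe_finset,
    Finset.coe_filter_univ]
  rw [Finset.disjoint_left]
  intro x hx hx'
  obtain ⟨i, _, rfl⟩ := Finset.mem_image.1 hx'
  have := i.val_lt
  rw [mem_staircase, place] at hx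
  simp only at hx
  omega

theorem IsTriangularPlus.diagram_eq {k : ℕ} [NeZero k] {p : n.Partition}
    (hp : IsTriangularPlus k p) : diagram p = colorDiagram k (level k p) := by
  ext ⟨i, j⟩
  rw [YoungDiagram.mem_cells, YoungDiagram.mem_cells, mem_colorDiagram]
  rcases lt_trichotomy (i + j + 1) k with hlt | heq | hgt
  · exact iff_of_true (hp.1 _ _ hlt) (Or.inl hlt)
  · rw [level_natCast heq]
    simp [heq]
  · exact iff_of_false (fun h => by have := hp.2 _ _ h; omega) (by omega)

theorem IsTriangularPlus.ncard_level {k r : ℕ} [NeZero k] (hn : n = (k - 1) * k / 2 + r)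
    {p : n.Partition} (hp : IsTriangularPlus k p) : {i | level k p i = true}.ncard = r := by
  have h := card_colorDiagram (level k p)
  rw [← hp.diagram_eq, card_diagram] at h
  omega

theorem exists_diagram_eq (μ : YoungDiagram) (hμ : μ.cells.card = n) :
    ∃ p : n.Partition, diagram p = μ := by
  have hsum : (μ.rowLens : Multiset ℕ).sum = n := by
    rw [Multiset.sum_coe, ← card_cellsOfRowLens, ← hμ]
    exact congrArg (fun ν : YoungDiagram => ν.cells.card) μ.ofRowLens_to_rowLens_eq_self
  refine ⟨⟨μ.rowLens, fun h => μ.pos_of_mem_rowLens _ h, hsum⟩, ?_⟩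
  have hsort : (μ.rowLens : Multiset ℕ).sort (· ≥ ·) = μ.rowLens := by
    rw [Multiset.coe_sort]
    exact List.mergeSort_eq_self _ (by simpa using μ.rowLens_sorted.pairwise)
  conv_rhs => rw [← μ.ofRowLens_to_rowLens_eq_self]
  simp only [diagram, hsort]

theorem exists_isTriangularPlus_level_eq {k r : ℕ} [NeZero k] (hn : n = (k - 1) * k / 2 + r)
    (c : Coloring k r) : ∃ p : n.Partition, IsTriangularPlus k p ∧ level k p = c.color := by
  obtain ⟨p, hp⟩ := exists_diagram_eq (n := n) (colorDiagram k c.color) (by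
    rw [card_colorDiagram, c.ncard_black, hn])
  refine ⟨p, ⟨fun i j h => ?_, fun i j h => ?_⟩, funext fun i => ?_⟩
  · rw [hp, mem_colorDiagram]
    exact Or.inl h
  · rw [hp, mem_colorDiagram] at h
    omega
  · have := i.val_lt
    rw [Bool.eq_iff_iff, level, decide_eq_true_iff, hp, mem_colorDiagram, ZMod.natCast_zmod_val]
    constructor
    · rintro (h | h)
      · omega
      · exact h.2
    · exact fun h => Or.inr ⟨by omega, h⟩

/-! ### Components and necklaces. -/

theorem exists_isTriangularPlus_iterate {k r : ℕ} (hr : 0 < r) (hrk : r ≤ k)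
    (hn : n = (k - 1) * k / 2 + r) (p : n.Partition) :
    ∃ s, IsTriangularPlus k (move^[s] p) := by
  obtain ⟨s, hs⟩ := exists_iterate_mem_periodicPts (move (n := n)) p
  exact ⟨s, isTriangularPlus_of_balanced hr hrk hn (balanced_iterate_of_mem_periodicPts hs)⟩

theorem component_move (p : n.Partition) : component (move p) = component p := by
  -- A simple graph has no loops, so a fixed point of `move` yields no edge.
  by_cases h : move p = p
  · rw [h]
  · refine SimpleGraph.ConnectedComponent.sound (SimpleGraph.Adj.reachable ?_)
    exact ⟨h, Or.inr rfl⟩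

theorem component_iterate_move (p : n.Partition) (s : ℕ) :
    component (move^[s] p) = component p := by
  induction s with
  | zero => rfl
  | succ s ih => rw [Function.iterate_succ_apply', component_move, ih]

/-- The colouring of level `k` of a triangular partition plus surplus. -/
def IsTriangularPlus.coloring {k r : ℕ} [NeZero k] (hn : n = (k - 1) * k / 2 + r)
    {p : n.Partition} (hp : IsTriangularPlus k p) : Coloring k r :=
  ⟨level k p, hp.ncard_level hn⟩

theorem IsTriangularPlus.coloring_iterate {k r : ℕ} [NeZero k] (hn : n = (k - 1) * k / 2 + r)
    {p : n.Partition} (hp : IsTriangularPlus k p) (t : ℕ) :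
    (hp.iterate_move t).coloring hn = (t : ZMod k) +ᵥ hp.coloring hn := by
  refine Coloring.ext (funext fun i => ?_)
  have h := hp.level_iterate t (i - t)
  rwa [sub_add_cancel] at h

theorem necklace_eq_iff {k r : ℕ} {c c' : Coloring k r} :
    necklace c = necklace c' ↔ ∃ t : ZMod k, t +ᵥ c' = c :=
  Quotient.eq.trans Iff.rfl

theorem IsTriangularPlus.necklace_iterate {k r : ℕ} [NeZero k] (hn : n = (k - 1) * k / 2 + r)
    {p : n.Partition} (hp : IsTriangularPlus k p) (t : ℕ) {q : n.Partition}
    (hq : IsTriangularPlus k q) (h : BulgarianSolitaire.move^[t] p = q) :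
    necklace (hq.coloring hn) = necklace (hp.coloring hn) := by
  subst h
  exact necklace_eq_iff.2 ⟨t, (hp.coloring_iterate hn t).symm⟩

theorem necklace_eq_of_iterates {k r : ℕ} [NeZero k] (hn : n = (k - 1) * k / 2 + r)
    {p : n.Partition} {s t : ℕ} (hs : IsTriangularPlus k (move^[s] p))
    (ht : IsTriangularPlus k (move^[t] p)) :
    necklace (hs.coloring hn) = necklace (ht.coloring hn) := by
  wlog hst : s ≤ t generalizing s t
  · exact (this ht hs (by omega)).symm
  refine (hs.necklace_iterate hn (t - s) ht ?_).symm
  rw [← Function.iterate_add_apply, Nat.sub_add_cancel hst]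

/-- Reading off level `k` on the cycle is a bijection from components to necklaces. -/
theorem exists_componentEquivNecklace {k r : ℕ} [NeZero k] (hr : 0 < r) (hrk : r ≤ k)
    (hn : n = (k - 1) * k / 2 + r) :
    ∃ e : Component n ≃ Necklace k r, ∀ (p : n.Partition) (hp : IsTriangularPlus k p),
      e (component p) = necklace (hp.coloring hn) := by
  choose s hs using exists_isTriangularPlus_iterate hr hrk hn
  let f : n.Partition → Necklace k r := fun p => necklace ((hs p).coloring hn)
  -- Both necklaces come from iterates of `p` itself, and the choice of the iterate does not matter.
  have hf : ∀ p, f (move p) = f p := fun p =>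
    necklace_eq_of_iterates (p := p) (s := s (move p) + 1) hn (hs (move p)) (hs p)
  have hadj : ∀ p q : n.Partition, (graph n).toSimpleGraphInclusive.Adj p q → f p = f q := by
    rintro p q ⟨-, h | h⟩
    · rw [show q = move p from h, hf]
    · rw [show p = move q from h, hf]
  let g : Component n → Necklace k r := SimpleGraph.ConnectedComponent.lift f fun p q w _ => by
    clear * - hadj w
    induction w with
    | nil => rfl
    | cons h _ ih => exact (hadj _ _ h).trans ih
  have hgT : ∀ (p : n.Partition) (hp : IsTriangularPlus k p),
      g (component p) = necklace (hp.coloring hn) := fun p hp =>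
    necklace_eq_of_iterates (t := 0) hn (hs p) hp
  have hrep : ∀ C : Component n, ∃ p, IsTriangularPlus k p ∧ component p = C := fun C => by
    obtain ⟨p, rfl⟩ := Quot.exists_rep C
    exact ⟨_, hs p, component_iterate_move p _⟩
  refine ⟨Equiv.ofBijective g ⟨fun C C' h => ?_, fun N => ?_⟩, hgT⟩
  · obtain ⟨p, hp, rfl⟩ := hrep C
    obtain ⟨q, hq, rfl⟩ := hrep C'
    rw [hgT p hp, hgT q hq, necklace_eq_iff] at h
    obtain ⟨t, ht⟩ := h
    -- The rotation by `t` is realized by `t.val` moves, so `p` lies on the orbit of `q`.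
    have hc := hq.coloring_iterate hn t.val
    rw [ZMod.natCast_zmod_val, ht] at hc
    rw [← (hq.iterate_move t.val).eq_of_level_eq hp (congrArg Coloring.color hc),
      component_iterate_move]
  · obtain ⟨c, rfl⟩ := Quotient.exists_rep N
    obtain ⟨p, hp, hc⟩ := exists_isTriangularPlus_level_eq hn c
    refine ⟨component p, (hgT p hp).trans ?_⟩
    exact congrArg necklace (Coloring.ext hc)

/-! ### Counting necklaces with Burnside's lemma. -/

instance (k r : ℕ) [NeZero k] : Finite (Coloring k r) :=
  Finite.of_injective Coloring.color fun _ _ => Coloring.ext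

/-- The stabilizer is a subgroup, so it contains all multiples of `t`; this form lets the colouring
descend to the cosets. -/
theorem mem_fixedBy_iff {k r : ℕ} {t : ZMod k} {c : Coloring k r} :
    c ∈ AddAction.fixedBy (Coloring k r) t ↔
      ∀ i, ∀ h ∈ AddSubgroup.zmultiples t, c.color (i + h) = c.color i := by
  rw [AddAction.mem_fixedBy]
  constructor
  · intro hc i h hh
    have h1 : h ∈ AddAction.stabilizer (ZMod k) c :=
      (AddSubgroup.zmultiples_le.2 (AddAction.mem_stabilizer_iff.2 hc)) hh
    have h2 := congrFun (congrArg Coloring.color (AddAction.mem_stabilizer_iff.1 h1)) (i + h)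
    rw [← h2]
    exact congrArg c.color (add_sub_cancel_right i h)
  · intro hc
    refine Coloring.ext (funext fun i => ?_)
    have := hc (i - t) t (AddSubgroup.mem_zmultiples t)
    rw [sub_add_cancel] at this
    exact this.symm

theorem ncard_preimage_mk {G : Type*} [AddGroup G] (H : AddSubgroup G) (T : Set (G ⧸ H)) :
    ((QuotientAddGroup.mk : G → G ⧸ H) ⁻¹' T).ncard = Nat.card H * T.ncard := by
  rw [← Nat.card_coe_set_eq, Nat.card_congr 
    (QuotientAddGroup.preimageMkEquivAddSubgroupProdSet H T), Nat.card_prod, Nat.card_coe_set_eq]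

/-- Colourings fixed by a rotation are colourings of the cosets of the subgroup it generates. -/
noncomputable def fixedByEquiv (k r : ℕ) (t : ZMod k) :
    AddAction.fixedBy (Coloring k r) t ≃
      {T : Set (ZMod k ⧸ AddSubgroup.zmultiples t) // addOrderOf t * T.ncard = r} where
  toFun c := ⟨{x | Quotient.liftOn' x c.1.color (fun a b hab => by
      have := mem_fixedBy_iff.1 c.2 a (-a + b) (QuotientAddGroup.leftRel_apply.1 hab)
      rw [← this, add_neg_cancel_left]) = true}, by
    rw [← Nat.card_zmultiples, ← ncard_preimage_mk]
    exact c.1.ncard_black⟩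
  invFun T := ⟨⟨fun i => open Classical in
      decide ((i : ZMod k ⧸ AddSubgroup.zmultiples t) ∈ T.1), by
      simp only [decide_eq_true_eq]
      refine Eq.trans (ncard_preimage_mk _ T.1) ?_
      rw [Nat.card_zmultiples, T.2]⟩, mem_fixedBy_iff.2 fun i h hh => by
      have : ((i + h : ZMod k) : ZMod k ⧸ AddSubgroup.zmultiples t) = i :=
        QuotientAddGroup.mk_add_of_mem i hh
      exact decide_eq_decide.2 (by rw [this])⟩
  left_inv c := by
    refine Subtype.ext (Coloring.ext (funext fun i => ?_))
    refine Bool.eq_iff_iff.2 ((@decide_eq_true_iff _ (_)).trans Iff.rfl)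
  right_inv T := by
    refine Subtype.ext (Set.ext fun x => ?_)
    induction x using QuotientAddGroup.induction_on with
    | H x => simp

theorem card_sets_ncard_eq {α : Type*} [Finite α] (m : ℕ) :
    Nat.card {T : Set α // T.ncard = m} = (Nat.card α).choose m := by
  have := Fintype.ofFinite α
  rw [Nat.card_eq_fintype_card (α := α), ← Fintype.card_finset_len, ← Nat.card_eq_fintype_card]
  refine Nat.card_congr (Fintype.finsetEquivSet.subtypeEquiv fun s => ?_).symm
  rw [Fintype.finsetEquivSet_apply, Set.ncard_coe_finset]

/-- With `d = addOrderOf t`, each black coset has `d` beads, so a fixed colouring is a choice of `r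
/ d` of the `k / d` cosets, impossible unless `d ∣ r`. -/
theorem card_fixedBy (k r : ℕ) [NeZero k] (t : ZMod k) :
    Nat.card (AddAction.fixedBy (Coloring k r) t) =
      if addOrderOf t ∣ r then (k / addOrderOf t).choose (r / addOrderOf t) else 0 := by
  have hpos : 0 < addOrderOf t := addOrderOf_pos t
  rw [Nat.card_congr (fixedByEquiv k r t)]
  split_ifs with h
  · obtain ⟨m, rfl⟩ := h
    have hq : Nat.card (ZMod k ⧸ AddSubgroup.zmultiples t) = k / addOrderOf t := by
      have := AddSubgroup.card_eq_card_quotient_mul_card_addSubgroup (AddSubgroup.zmultiples t)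
      rw [Nat.card_zmultiples, Nat.card_zmod] at this
      exact (Nat.div_eq_of_eq_mul_left hpos this).symm
    rw [Nat.mul_div_cancel_left _ hpos, ← hq]
    simp only [Nat.mul_left_cancel_iff hpos]
    exact card_sets_ncard_eq m
  · have : IsEmpty {T : Set (ZMod k ⧸ AddSubgroup.zmultiples t) // addOrderOf t * T.ncard = r} :=
      ⟨fun T => h ⟨_, T.2.symm⟩⟩
    exact Nat.card_of_isEmpty

theorem card_necklace_mul (k r : ℕ) [NeZero k] (hr : 0 < r) :
    Nat.card (Necklace k r) * k =
      ∑ d ∈ (Nat.gcd r k).divisors, Nat.totient d * Nat.choose (k / d) (r / d) := by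
  classical
  have := Fintype.ofFinite (Coloring k r)
  have hB := AddAction.sum_card_fixedBy_eq_card_orbits_mul_card_addGroup (ZMod k) (Coloring k r)
  rw [ZMod.card, ← Nat.card_eq_fintype_card] at hB
  rw [← hB]
  simp only [← Nat.card_eq_fintype_card, card_fixedBy]
  have hk := NeZero.ne k
  -- The rotations are grouped by their order `d`; `d.totient` of them have order `d`.
  rw [← Finset.sum_fiberwise_of_maps_to (s := Finset.univ) (t := k.divisors)
    (g := fun t : ZMod k => addOrderOf t)
    (fun t _ => Nat.mem_divisors.2 ⟨by simpa using addOrderOf_dvd_card (x := t), hk⟩)]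
  have hsub : (Nat.gcd r k).divisors = k.divisors.filter (· ∣ r) := by
    ext d
    simp only [Nat.mem_divisors, Finset.mem_filter, Nat.dvd_gcd_iff]
    have := Nat.gcd_pos_of_pos_left k hr
    constructor
    · rintro ⟨⟨h1, h2⟩, -⟩
      exact ⟨⟨h2, hk⟩, h1⟩
    · rintro ⟨⟨h1, -⟩, h2⟩
      exact ⟨⟨h2, h1⟩, this.ne'⟩
  rw [hsub, Finset.sum_filter]
  refine Finset.sum_congr rfl fun d hd => ?_
  have hcard : (Finset.univ.filter fun t : ZMod k => addOrderOf t = d).card = d.totient :=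
    IsAddCyclic.card_addOrderOf_eq_totient (by rw [ZMod.card]; exact Nat.dvd_of_mem_divisors hd)
  rw [← hcard, Finset.sum_congr rfl (g := fun _ => if d ∣ r then (k / d).choose (r / d) else 0)
    (fun t ht => by rw [(Finset.mem_filter.1 ht).2])]
  rw [Finset.sum_const, smul_eq_mul]
  split_ifs <;> simp

end BulgarianSolitaire

theorem theorem2 (n k r : ℕ) (hr : 0 < r) (hrk : r ≤ k) (hn : n = (k - 1) * k / 2 + r) :
    -- every orbit reaches a triangular partition plus boxes on level `k`, and stays on its cycle
    (∀ p : n.Partition, ∃ s₀ : ℕ, ∀ s ≥ s₀,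
      BulgarianSolitaire.IsTriangularPlus k (BulgarianSolitaire.move^[s] p) ∧
      BulgarianSolitaire.move^[s] p ∈ Function.periodicPts (BulgarianSolitaire.move (n := n))) ∧
    -- the partitions on the cycles are exactly those of this shape
    (∀ p : n.Partition, p ∈ Function.periodicPts (BulgarianSolitaire.move (n := n)) ↔
      BulgarianSolitaire.IsTriangularPlus k p) ∧
    -- there are exactly `r` boxes on level `k`, and the move rotates them cyclically by one place
    (∀ p : n.Partition, BulgarianSolitaire.IsTriangularPlus k p →
      {i | BulgarianSolitaire.level k p i = true}.ncard = r ∧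
      ∀ i : ZMod k, BulgarianSolitaire.level k (BulgarianSolitaire.move p) (i + 1) =
        BulgarianSolitaire.level k p i) ∧
    -- reading off level `k` of the cycle is a bijection from components to necklaces
    (∃ e : BulgarianSolitaire.Component n ≃ BulgarianSolitaire.Necklace k r,
      ∀ p : n.Partition, BulgarianSolitaire.IsTriangularPlus k p →
        ∃ h : {i | BulgarianSolitaire.level k p i = true}.ncard = r,
          e (BulgarianSolitaire.component p) =
            BulgarianSolitaire.necklace ⟨BulgarianSolitaire.level k p, h⟩) ∧
    -- the number of components, which is the number of necklaces
    Nat.card (BulgarianSolitaire.Component n) = Nat.card (BulgarianSolitaire.Necklace k r) ∧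
    (Nat.card (BulgarianSolitaire.Component n) : ℚ) =
      1 / (k : ℚ) * ∑ d ∈ (Nat.gcd r k).divisors,
        (Nat.totient d : ℚ) * (Nat.choose (k / d) (r / d) : ℚ) := by
  
  have hk : NeZero k := ⟨by omega⟩
  have hfin : ∀ p : n.Partition, p ∈ Function.periodicPts (BulgarianSolitaire.move (n := n)) ↔
      BulgarianSolitaire.IsTriangularPlus k p := fun p =>
    ⟨fun h => BulgarianSolitaire.isTriangularPlus_of_balanced hr hrk hn
      (BulgarianSolitaire.balanced_iterate_of_mem_periodicPts h), fun h => h.mem_periodicPts⟩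
  obtain ⟨e, he⟩ := BulgarianSolitaire.exists_componentEquivNecklace hr hrk hn
  have hcard := Nat.card_congr e
  refine ⟨fun p => ?_, hfin, fun p hp => ⟨hp.ncard_level hn, hp.balanced.level_move k⟩,
    ⟨e, fun p hp => ⟨hp.ncard_level hn, he p hp⟩⟩, hcard, ?_⟩
  · obtain ⟨s₀, hs₀⟩ := BulgarianSolitaire.exists_isTriangularPlus_iterate hr hrk hn p
    refine ⟨s₀, fun s hs => ?_⟩
    have h := hs₀.iterate_move (s - s₀)
    rw [← Function.iterate_add_apply, Nat.sub_add_cancel hs] at h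
    exact ⟨h, h.mem_periodicPts⟩
  · have hk0 : (k : ℚ) ≠ 0 := Nat.cast_ne_zero.2 hk.out
    rw [hcard, one_div, eq_inv_mul_iff_mul_eq₀ hk0, mul_comm]
    exact_mod_cast BulgarianSolitaire.card_necklace_mul k r hr
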